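/- All graphs are finite and simple. For a graph $G$, let $\lambda_1(G)$ denote the largest eigenvalue of its adjacency matrix. The leaf degree of a tree $T$ is the maximum, over all vertices $v$ of $T$, of the number of vertices of degree $1$ in $T$ that are adjacent to $v$ in $T$. Write $G_1\cup G_2$ for the disjoint union of two graphs, $mK_1$ for the edgeless graph on $m$ vertices, $K_m$ for the complete graph on $m$ vertices, and $G_1\vee G_2$ for the join, obtained from $G_1\cup G_2$ by adding all edges between $G_1$ and $G_2$. Let $k\ge 1$ be an integer and let $G$ be a connected graph of order $n\ge 2k+12$. If $$\lambda_1(G)\ \ge\ \lambda_1\bigl(K_1\vee (K_{n-(k+2)}\cup (k+1)K_1)\bigr),$$ then $G$ has a spanning tree with leaf degree at most $k$, unless $G\cong K_1\vee (K_{n-(k+2)}\cup (k+1)K_1)$, in which case $G$ has no such spanning tree. -/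

import Mathlib

namespace SpanningLeaf

/-- The join `G ∨ H` of two graphs: the disjoint union together with all edges between the
two parts. -/
def join {V W : Type*} (G : SimpleGraph V) (H : SimpleGraph W) : SimpleGraph (V ⊕ W) where
  Adj
    | Sum.inl u, Sum.inl v => G.Adj u v
    | Sum.inr u, Sum.inr v => H.Adj u v
    | Sum.inl _, Sum.inr _ => True
    | Sum.inr _, Sum.inl _ => True
  symm := ⟨by
    rintro (u | u) (v | v) h
    · exact SimpleGraph.Adj.symm h
    · trivial
    · trivial
    · exact SimpleGraph.Adj.symm h⟩
  loopless := ⟨by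
    rintro (u | u) h
    · exact G.loopless.irrefl u h
    · exact H.loopless.irrefl u h⟩

/-- The graph `K_1 ∨ (K_{n-(k+2)} ∪ (k+1) K_1)`; it has `n` vertices when `k + 2 ≤ n`. The edgeless
graph on `k + 1` vertices is `(k+1) K_1`, and `⊕g` is the disjoint union of graphs. -/
def extremalGraph (n k : ℕ) : SimpleGraph (Fin 1 ⊕ (Fin (n - (k + 2)) ⊕ Fin (k + 1))) :=
  join (SimpleGraph.completeGraph (Fin 1))
    (SimpleGraph.sum (SimpleGraph.completeGraph (Fin (n - (k + 2))))
      (SimpleGraph.emptyGraph (Fin (k + 1))))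

open Classical in
/-- The largest eigenvalue `λ₁(G)` of the real adjacency matrix of a finite nonempty graph. The
supremum runs over the finite family of all eigenvalues, so it is a maximum. -/
noncomputable def lambdaOne {V : Type*} [Fintype V] (G : SimpleGraph V) : ℝ :=
  ⨆ i : V, (G.isHermitian_adjMatrix ℝ).eigenvalues i

open Classical in
/-- The leaf degree of `T`: the maximum, over all vertices `v`, of the number of end vertices
(vertices of degree `1`) of `T` that are adjacent to `v` in `T`. -/
noncomputable def leafDegree {V : Type*} [Fintype V] (T : SimpleGraph V) : ℕ :=
  Finset.univ.sup fun v : V =>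
    (Finset.univ.filter fun u : V => T.Adj v u ∧ T.degree u = 1).card

/-- `T` is a spanning tree of `G`: a tree on all the vertices of `G`, every edge of which is an
edge of `G`. -/
def IsSpanningTree {V : Type*} (T G : SimpleGraph V) : Prop :=
  T ≤ G ∧ T.IsTree

end SpanningLeaf

/-! Kaneko's criterion links the two sides: a connected graph on at least four vertices with `i(G -
S) < (k + 1)|S|` for all nonempty `S` has a spanning tree of leaf degree at most `k`. For the proof,
take an edge-minimal connected spanning subgraph that keeps the condition. The leaves at `v` have
neighbourhood `{v}`, so there are at most `k` of them. The subgraph is a tree because every cycle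
has a deletable edge (`KanekoCondition.exists_edge_of_cycle`). Otherwise each edge of the cycle has
a set `S` obstructing its deletion. An exchange count (`KanekoCondition.detaches_next`) carries an
obstruction to every second edge in one direction. The resulting tight sets, uncrossed by
submodularity, grow round the cycle until they violate the condition
(`KanekoCondition.not_forall_detaches`).

Suppose now that the condition fails at `S`. If `|S| = 1`, then `G` is a spanning subgraph of the
extremal graph, and `λ₁` is strictly monotone (`lambdaOne_lt_of_embedding`). If `|S| ≥ 2`, a test
vector gives `λ₁(G) < n - k - 2` (`lambdaOne_lt_of_isolated`), while a clique in the extremal graph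
gives the reverse bound there. In the extremal graph itself, the pendant vertices remain leaves at
the centre of every spanning tree. -/

namespace SpanningLeaf

/-! ### Kaneko's condition and neighbourhoods -/

open scoped Classical in
/-- The isolated vertices of `G - S`. -/
noncomputable def isolated {V : Type*} [Fintype V] (G : SimpleGraph V) (S : Finset V) : Finset V :=
  Finset.univ.filter fun v => v ∉ S ∧ ∀ w, G.Adj v w → w ∈ S

open scoped Classical in
/-- The vertices with a neighbour in `X`. -/
noncomputable def nbhd {V : Type*} [Fintype V] (G : SimpleGraph V) (X : Finset V) : Finset V :=
  Finset.univ.filter fun w => ∃ v ∈ X, G.Adj v w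

/-- Kaneko's condition: `i(G - S) < (k + 1) |S|` for all nonempty `S`. -/
def KanekoCondition {V : Type*} [Fintype V] (G : SimpleGraph V) (k : ℕ) : Prop :=
  ∀ S : Finset V, S.Nonempty → (isolated G S).card < (k + 1) * S.card

section

open scoped Classical

variable {V : Type*} [Fintype V] {G : SimpleGraph V} {k : ℕ}

lemma mem_isolated {S : Finset V} {v : V} :
    v ∈ isolated G S ↔ v ∉ S ∧ ∀ w, G.Adj v w → w ∈ S := by
  simp [isolated]

lemma mem_nbhd {X : Finset V} {w : V} : w ∈ nbhd G X ↔ ∃ v ∈ X, G.Adj v w := by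
  simp [nbhd]

lemma nbhd_isolated_subset (S : Finset V) : nbhd G (isolated G S) ⊆ S := by
  intro w hw
  obtain ⟨v, hv, hvw⟩ := mem_nbhd.1 hw
  exact (mem_isolated.1 hv).2 w hvw

lemma nbhd_union (X Y : Finset V) : nbhd G (X ∪ Y) = nbhd G X ∪ nbhd G Y := by
  ext w
  simp only [mem_nbhd, Finset.mem_union]
  grind

lemma nbhd_mono {X Y : Finset V} (h : X ⊆ Y) : nbhd G X ⊆ nbhd G Y := by
  intro w hw
  obtain ⟨v, hv, hvw⟩ := mem_nbhd.1 hw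
  exact mem_nbhd.2 ⟨v, h hv, hvw⟩

/-- In terms of neighbourhoods, Kaneko's condition says `|X| < (k + 1) |N(X)|`, for every nonempty
set `X`, independent or not. -/
lemma KanekoCondition.card_lt_nbhd (hK : KanekoCondition G k) (hk : 1 ≤ k)
    (hiso : ∀ v, ∃ w, G.Adj v w) {X : Finset V} (hX : X.Nonempty) :
    X.card < (k + 1) * (nbhd G X).card := by
  set N := nbhd G X with hN
  have hNne : N.Nonempty := by
    obtain ⟨x, hx⟩ := hX
    obtain ⟨w, hw⟩ := hiso x
    exact ⟨w, mem_nbhd.2 ⟨x, hx, hw⟩⟩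
  -- `X₀` is independent and its neighbourhood misses `X ∩ N`, so each vertex of `X ∩ N` uses up one
  -- element of `N`, worth `k + 1 ≥ 2`.
  set X₀ := X \ N with hX₀
  have hcard : X.card = X₀.card + (X ∩ N).card := by
    rw [hX₀, Finset.card_sdiff_add_card_inter]
  have hsub : nbhd G X₀ ⊆ N \ (X ∩ N) := by
    intro w hw
    obtain ⟨v, hv, hvw⟩ := mem_nbhd.1 hw
    rw [hX₀, Finset.mem_sdiff] at hv
    refine Finset.mem_sdiff.2 ⟨mem_nbhd.2 ⟨v, hv.1, hvw⟩, fun h => hv.2 ?_⟩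
    exact mem_nbhd.2 ⟨w, (Finset.mem_inter.1 h).1, hvw.symm⟩
  have hle : (nbhd G X₀).card + (X ∩ N).card ≤ N.card := by
    have h1 := Finset.card_le_card hsub
    have h2 := Finset.card_sdiff_add_card_eq_card (Finset.inter_subset_right : X ∩ N ⊆ N)
    omega
  have hNpos := hNne.card_pos
  rcases X₀.eq_empty_or_nonempty with h0 | ⟨x, hx⟩
  · rw [h0] at hcard
    simp only [Finset.card_empty] at hcard
    nlinarith
  · have hx' := hx
    rw [hX₀, Finset.mem_sdiff] at hx'
    obtain ⟨w, hw⟩ := hiso x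
    have h1 := hK (nbhd G X₀) ⟨w, mem_nbhd.2 ⟨x, hx, hw⟩⟩
    have h2 : X₀ ⊆ isolated G (nbhd G X₀) := by
      intro v hv
      refine mem_isolated.2 ⟨fun h => ?_, fun w hw => mem_nbhd.2 ⟨v, hv, hw⟩⟩
      have := Finset.mem_sdiff.1 (hsub h)
      rw [hX₀, Finset.mem_sdiff] at hv
      exact hv.2 this.1
    have h3 := Finset.card_le_card h2
    nlinarith

/-! ### Obstructions to deleting an edge, and their exchange -/

/-- A set witnessing that deleting the edge `xy` breaks Kaneko's condition by isolating `x` alone. -/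
def Detaches (G : SimpleGraph V) (k : ℕ) (x y : V) (S : Finset V) : Prop :=
  S.Nonempty ∧ x ∉ S ∧ y ∉ S ∧ (∀ w, G.Adj x w → w ∈ S ∨ w = y) ∧
    (k + 1) * S.card ≤ (isolated G S).card + 1

/-- A set witnessing that deleting the edge `xy` breaks Kaneko's condition by isolating both `x` and
`y`. -/
def DetachesBoth (G : SimpleGraph V) (k : ℕ) (x y : V) (S : Finset V) : Prop :=
  S.Nonempty ∧ x ∉ S ∧ y ∉ S ∧ (∀ w, G.Adj x w → w ∈ S ∨ w = y) ∧
    (∀ w, G.Adj y w → w ∈ S ∨ w = x) ∧ (k + 1) * S.card ≤ (isolated G S).card + 2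

/-- The three ways in which the deletion of an edge can break Kaneko's condition. -/
lemma KanekoCondition.exists_detaches (hK : KanekoCondition G k) {x y : V}
    (hnot : ¬ KanekoCondition (G \ SimpleGraph.edge x y) k) :
    (∃ S, Detaches G k x y S) ∨ (∃ S, Detaches G k y x S) ∨ ∃ S, DetachesBoth G k x y S := by
  simp only [KanekoCondition, not_forall, not_lt] at hnot
  obtain ⟨S, hS, hle⟩ := hnot
  have hlt := hK S hS
  have hadj : ∀ v w, G.Adj v w → (G \ SimpleGraph.edge x y).Adj v w ∨
      (v = x ∧ w = y) ∨ (v = y ∧ w = x) := by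
    intro v w h
    simp only [SimpleGraph.sdiff_adj, SimpleGraph.edge_adj]
    have := h.ne
    tauto
  have hmem : ∀ v ∈ isolated (G \ SimpleGraph.edge x y) S, v ∉ isolated G S →
      (v = x ∧ x ∉ S ∧ y ∉ S ∧ ∀ w, G.Adj x w → w ∈ S ∨ w = y) ∨
      (v = y ∧ x ∉ S ∧ y ∉ S ∧ ∀ w, G.Adj y w → w ∈ S ∨ w = x) := by
    intro v hv hv'
    rw [mem_isolated] at hv hv'
    push Not at hv'
    obtain ⟨w, hw, hwS⟩ := hv' hv.1
    have hall : ∀ w, G.Adj v w → w ∈ S ∨ (v = x ∧ w = y) ∨ (v = y ∧ w = x) := fun w hw =>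
      (hadj v w hw).imp_left (hv.2 w)
    rcases (hall w hw).resolve_left hwS with ⟨rfl, rfl⟩ | ⟨rfl, rfl⟩
    · left
      refine ⟨rfl, hv.1, hwS, fun z hz => ?_⟩
      have := hall z hz
      have := hz.ne
      grind
    · right
      refine ⟨rfl, hwS, hv.1, fun z hz => ?_⟩
      have := hall z hz
      have := hz.ne
      grind
  by_cases hx : x ∈ isolated (G \ SimpleGraph.edge x y) S ∧ x ∉ isolated G S
  · by_cases hy : y ∈ isolated (G \ SimpleGraph.edge x y) S ∧ y ∉ isolated G S
    · right; right
      have hx' := hmem x hx.1 hx.2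
      have hy' := hmem y hy.1 hy.2
      have hsub : isolated (G \ SimpleGraph.edge x y) S ⊆ insert x (insert y (isolated G S)) := by
        intro v hv
        by_cases hv' : v ∈ isolated G S
        · simp [hv']
        · have := hmem v hv hv'
          simp only [Finset.mem_insert]
          tauto
      have h1 := Finset.card_le_card hsub
      have h2 := Finset.card_insert_le x (insert y (isolated G S))
      have h3 := Finset.card_insert_le y (isolated G S)
      refine ⟨S, hS, ?_, ?_, ?_, ?_, by omega⟩ <;> grind
    · left
      have hx' := hmem x hx.1 hx.2
      have hsub : isolated (G \ SimpleGraph.edge x y) S ⊆ insert x (isolated G S) := by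
        intro v hv
        by_cases hv' : v ∈ isolated G S
        · simp [hv']
        · have := hmem v hv hv'
          simp only [Finset.mem_insert]
          grind
      have h1 := Finset.card_le_card hsub
      have h2 := Finset.card_insert_le x (isolated G S)
      refine ⟨S, hS, ?_, ?_, ?_, by omega⟩ <;> grind
  · right; left
    have hsub : isolated (G \ SimpleGraph.edge x y) S ⊆ insert y (isolated G S) := by
      intro v hv
      by_cases hv' : v ∈ isolated G S
      · simp [hv']
      · have := hmem v hv hv'
        simp only [Finset.mem_insert]
        grind
    by_cases hy : y ∈ isolated (G \ SimpleGraph.edge x y) S ∧ y ∉ isolated G S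
    · have hy' := hmem y hy.1 hy.2
      have h1 := Finset.card_le_card hsub
      have h2 := Finset.card_insert_le y (isolated G S)
      refine ⟨S, hS, ?_, ?_, ?_, by omega⟩ <;> grind
    · exfalso
      have hsub' : isolated (G \ SimpleGraph.edge x y) S ⊆ isolated G S := by
        intro v hv
        by_contra hv'
        have := hmem v hv hv'
        grind
      have := Finset.card_le_card hsub'
      omega

/-- The counting behind the exchange argument: the isolated vertices for `S` that survive the
removal of `Y` and `z` from `S`. -/
lemma card_isolated_le_of_sdiff {x y z w : V} {S S' : Finset V}
    (hyz : z ≠ y) (hxz : G.Adj x z) (hzw : G.Adj z w)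
    (hxS : ∀ u, G.Adj x u → u ∈ S ∨ u = y)
    (hzS' : z ∉ S' ∧ w ∉ S' ∧ ∀ u, G.Adj z u → u ∈ S' ∨ u = w)
    (hw : ∃ u, G.Adj w u ∧ u ≠ z) :
    ∃ S₁ : Finset V, S₁ ⊆ S.erase z ∧
      S₁.card + (isolated G S' ∩ S).card + 1 = S.card ∧
      (isolated G S).card ≤ (isolated G S₁).card + (isolated G S ∩ S').card +
        (if w ∈ isolated G S then 1 else 0) ∧
      (w ∈ isolated G S → S₁.Nonempty) ∧
      S₁ = S.erase z \ isolated G S' := by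
  have hzS : z ∈ S := (hxS z hxz).resolve_right hyz
  have hzY : z ∉ isolated G S' := fun h => hzS'.2.1 ((mem_isolated.1 h).2 w hzw)
  set S₁ := S.erase z \ isolated G S' with hS₁
  -- A neighbour of `v` in `isolated G S'` would put `v` in `S'`; having `z` as a neighbour would
  -- put `v` in `S'` or make it `w`.
  have hsub : (isolated G S \ S').erase w ⊆ isolated G S₁ := by
    intro v hv
    simp only [Finset.mem_erase, Finset.mem_sdiff] at hv
    obtain ⟨hvw, hv, hvS'⟩ := hv
    rw [mem_isolated] at hv
    refine mem_isolated.2 ⟨fun h => hv.1 ?_, fun u hu => ?_⟩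
    · simp only [hS₁, Finset.mem_erase, Finset.mem_sdiff] at h
      exact h.1.2
    · simp only [hS₁, Finset.mem_erase, Finset.mem_sdiff]
      refine ⟨⟨?_, hv.2 u hu⟩, fun h => hvS' ((mem_isolated.1 h).2 v hu.symm)⟩
      rintro rfl
      rcases hzS'.2.2 v hu.symm with h | h
      · exact hvS' h
      · exact hvw h
  refine ⟨S₁, Finset.sdiff_subset, ?_, ?_, ?_, rfl⟩
  · have h1 : S₁.card + (S.erase z ∩ isolated G S').card = (S.erase z).card :=
      Finset.card_sdiff_add_card_inter (S.erase z) (isolated G S')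
    have h2 : S.erase z ∩ isolated G S' = isolated G S' ∩ S := by
      ext u
      simp only [Finset.mem_inter, Finset.mem_erase]
      constructor
      · tauto
      · rintro ⟨h, h'⟩
        exact ⟨⟨fun e => hzY (e ▸ h), h'⟩, h⟩
    have h3 := Finset.card_erase_add_one hzS
    rw [h2] at h1
    omega
  · have h1 := Finset.card_le_card hsub
    have h2 := Finset.card_sdiff_add_card_inter (isolated G S) S'
    split_ifs with hwX
    · have h3 := Finset.pred_card_le_card_erase (s := isolated G S \ S') (a := w)
      omega
    · rw [Finset.erase_eq_of_notMem (fun h => hwX (Finset.mem_sdiff.1 h).1)] at h1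
      omega
  · intro hwX
    obtain ⟨u, hu, huz⟩ := hw
    refine ⟨u, ?_⟩
    simp only [hS₁, Finset.mem_erase, Finset.mem_sdiff]
    exact ⟨⟨huz, (mem_isolated.1 hwX).2 u hu⟩,
      fun h => hzS'.2.1 ((mem_isolated.1 h).2 w hu.symm)⟩

lemma KanekoCondition.isolated_card_le (hK : KanekoCondition G k)
    (hiso : ∀ v, ∃ w, G.Adj v w) (S : Finset V) :
    (isolated G S).card ≤ (k + 1) * S.card := by
  rcases S.eq_empty_or_nonempty with rfl | hS
  · suffices isolated G ∅ = ∅ by simp [this]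
    ext v
    obtain ⟨w, hw⟩ := hiso v
    simp only [mem_isolated, Finset.notMem_empty, iff_false, not_and, not_forall]
    exact fun _ => ⟨w, hw, id⟩
  · exact (hK S hS).le

/-- Kaneko's condition for `S₁` cancels the main terms of `card_isolated_le_of_sdiff`. The extra one
for `w` is absorbed by strictness, since `S₁` is nonempty in that case. -/
lemma KanekoCondition.succ_mul_le (hK : KanekoCondition G k)
    (hiso : ∀ v, ∃ w, G.Adj v w) {x y z w : V} {S S' : Finset V} {δ : ℕ}
    (hyz : z ≠ y) (hxz : G.Adj x z) (hzw : G.Adj z w)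
    (hxS : ∀ u, G.Adj x u → u ∈ S ∨ u = y)
    (hzS' : z ∉ S' ∧ w ∉ S' ∧ ∀ u, G.Adj z u → u ∈ S' ∨ u = w)
    (hw : ∃ u, G.Adj w u ∧ u ≠ z) (hδ : (k + 1) * S.card ≤ (isolated G S).card + δ) :
    (k + 1) * ((isolated G S' ∩ S).card + 1) ≤ (isolated G S ∩ S').card + δ := by
  obtain ⟨S₁, -, h1, h2, h3, -⟩ := card_isolated_le_of_sdiff hyz hxz hzw hxS hzS' hw
  have h4 := hK.isolated_card_le hiso S₁
  rw [← h1] at hδ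
  split_ifs at h2 with hwX
  · have := hK S₁ (h3 hwX)
    nlinarith
  · nlinarith

/-- Serves to rule out the triangle: for `k = 1` it satisfies Kaneko's condition, but its spanning
trees have leaf degree 2. -/
lemma card_le_three_of_closed (hconn : G.Connected) {x y z : V}
    (hx : ∀ u, G.Adj x u → u = y ∨ u = z) (hy : ∀ u, G.Adj y u → u = x ∨ u = z)
    (hz : ∀ u, G.Adj z u → u = x ∨ u = y) : Fintype.card V ≤ 3 := by
  have hall : ∀ v, v ∈ ({x, y, z} : Finset V) := by
    intro v
    obtain ⟨p⟩ := hconn.preconnected v x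
    induction p with
    | nil => simp
    | cons h p ih =>
      have := ih hx hy hz
      simp only [Finset.mem_insert, Finset.mem_singleton] at this ⊢
      grind [SimpleGraph.Adj.symm]
  calc Fintype.card V = (Finset.univ : Finset V).card := rfl
    _ ≤ ({x, y, z} : Finset V).card := Finset.card_le_card fun v _ => hall v
    _ ≤ 3 := Finset.card_le_three

/-- If the deletion of `xy` isolates `x`, then the deletion of the edge `zw` at the next neighbour
`z` of `x` can only isolate `w`. -/
lemma KanekoCondition.detaches_next (hK : KanekoCondition G k) (hk : 1 ≤ k)
    (hconn : G.Connected) (hcard : 4 ≤ Fintype.card V) (hiso : ∀ v, ∃ w, G.Adj v w)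
    {x y z w : V} (hyz : z ≠ y) (hwx : w ≠ x) (hxy : G.Adj x y) (hxz : G.Adj x z)
    (hzw : G.Adj z w) (hy : ∃ u, G.Adj y u ∧ u ≠ x) (hw : ∃ u, G.Adj w u ∧ u ≠ z)
    (hQ : (∃ S, Detaches G k x y S) ∨ ∃ S, DetachesBoth G k x y S)
    (hb : ¬ KanekoCondition (G \ SimpleGraph.edge z w) k) :
    ∃ S, Detaches G k w z S := by
  -- With `a`, `b` the sizes of the two intersections, this adds `(k + 1)(b + 1) ≤ a + δ` and `(k +
  -- 1)(a + 1) ≤ b + ε`. For `δ, ε ≤ 2` only `δ = ε = 2`, `k = 1`, `a = b = 0` survives.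
  have key : ∀ {S S' : Finset V} {δ ε : ℕ}, x ∉ S → y ∉ S → (∀ u, G.Adj x u → u ∈ S ∨ u = y) →
      z ∉ S' → w ∉ S' → (∀ u, G.Adj z u → u ∈ S' ∨ u = w) →
      (k + 1) * S.card ≤ (isolated G S).card + δ → (k + 1) * S'.card ≤ (isolated G S').card + ε →
      2 * (k + 1) + k * ((isolated G S ∩ S').card + (isolated G S' ∩ S).card) ≤ δ + ε := by
    intro S S' δ ε h1 h2 h3 h4 h5 h6 h7 h8
    have e1 := hK.succ_mul_le hiso hyz hxz hzw h3 ⟨h4, h5, h6⟩ hw h7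
    have e2 := hK.succ_mul_le hiso hwx.symm hxz.symm hxy h6 ⟨h1, h2, h3⟩ hy h8
    nlinarith
  rcases hK.exists_detaches hb with ⟨S', hS', hz, hw', hzS', hc'⟩ | h | ⟨S', hB'⟩
  · exfalso
    rcases hQ with ⟨S, -, hx, hy', hxS, hc⟩ | ⟨S, -, hx, hy', hxS, -, hc⟩
    · have := key hx hy' hxS hz hw' hzS' hc hc'
      nlinarith
    · have := key hx hy' hxS hz hw' hzS' hc hc'
      nlinarith
  · exact h
  · obtain ⟨hS', hz, hw', hzS', hwS', hc'⟩ := hB'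
    rcases hQ with ⟨S, -, hx, hy', hxS, hc⟩ | ⟨S, hS, hx, hy', hxS, hyS, hc⟩
    · have := key hx hy' hxS hz hw' hzS' hc hc'
      nlinarith
    have hkey := key hx hy' hxS hz hw' hzS' hc hc'
    have hk1 : k = 1 := by nlinarith
    subst hk1
    have hb0 : (isolated G S' ∩ S).card = 0 := by omega
    have ha0 : (isolated G S ∩ S').card = 0 := by omega
    obtain ⟨S₁, hsub, h1, h2, -, hS₁⟩ :=
      card_isolated_le_of_sdiff hyz hxz hzw hxS ⟨hz, hw', hzS'⟩ hw
    obtain ⟨T₁, -, t1, t2, -, -⟩ :=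
      card_isolated_le_of_sdiff hwx.symm hxz.symm hxy hzS' ⟨hx, hy', hxS⟩ hy
    -- If `S₁` is empty then `S = {z}`, and either `x, y, z` exhaust the graph or `S'` isolates `y`
    -- without containing its neighbour `z`. Otherwise `S₁` itself is the witness for `w`.
    rcases S₁.eq_empty_or_nonempty with h0 | hne
    · exfalso
      rw [h0, Finset.card_empty] at h1
      obtain ⟨s, hs⟩ := Finset.card_eq_one.1 (show S.card = 1 by omega)
      have hzs : z = s := by
        have := (hxS z hxz).resolve_right hyz
        rwa [hs, Finset.mem_singleton] at this
      subst hzs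
      simp only [hs, Finset.mem_singleton] at hxS hyS
      rcases T₁.eq_empty_or_nonempty with h0' | hne'
      · rw [h0', Finset.card_empty] at t1
        obtain ⟨s, hs'⟩ := Finset.card_eq_one.1 (show S'.card = 1 by omega)
        have hxs : x = s := by
          have := (hzS' x hxz.symm).resolve_right hwx.symm
          rwa [hs', Finset.mem_singleton] at this
        subst hxs
        simp only [hs', Finset.mem_singleton] at hzS' hwS'
        have hyw : y = w := by
          obtain ⟨u, hu, hux⟩ := hy
          have hu' := (hyS u hu).resolve_right hux
          subst hu'
          exact (hzS' y hu.symm).resolve_left hxy.ne'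
        subst hyw
        have := card_le_three_of_closed hconn (x := x) (y := y) (z := z)
          (fun u hu => (hxS u hu).symm) (fun u hu => (hyS u hu).symm) hzS'
        omega
      · have hyY : y ∈ isolated G S' := by
          by_contra hyY
          rw [if_neg hyY] at t2
          have := hK T₁ hne'
          omega
        obtain ⟨u, hu, hux⟩ := hy
        have hu' := (hyS u hu).resolve_right hux
        subst hu'
        exact hz ((mem_isolated.1 hyY).2 u hu)
    · have hlt := hK S₁ hne
      have hwX : w ∈ isolated G S := by
        by_contra hwX
        rw [if_neg hwX] at h2
        omega
      rw [if_pos hwX] at h2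
      rw [mem_isolated] at hwX
      refine ⟨S₁, hne, fun h => hwX.1 (Finset.mem_of_mem_erase (hsub h)),
        fun h => Finset.notMem_erase z S (hsub h), fun u hu => ?_, by omega⟩
      by_cases huz : u = z
      · exact Or.inr huz
      · left
        rw [hS₁, Finset.mem_sdiff, Finset.mem_erase]
        exact ⟨⟨huz, hwX.2 u hu⟩, fun h => hw' ((mem_isolated.1 h).2 w hu.symm)⟩

/-! ### Tight sets and their growth along a cycle -/

/-- A nonempty set `X` attaining equality in `|X| < (k + 1) |N(X)|`. -/
def Tight (G : SimpleGraph V) (k : ℕ) (X : Finset V) : Prop :=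
  X.Nonempty ∧ (k + 1) * (nbhd G X).card ≤ X.card + 1

/-- `X` is `isolated G S`. Were its neighbourhood smaller than `S`, its size would fall below `(k +
1)(|S| - 1)`, against `Detaches`. -/
lemma Detaches.exists_tight (hK : KanekoCondition G k) (hk : 1 ≤ k)
    (hiso : ∀ v, ∃ w, G.Adj v w) {x y : V} {S : Finset V} (h : Detaches G k x y S)
    (hxy : G.Adj x y) :
    ∃ X, Tight G k X ∧ x ∉ X ∧ y ∉ nbhd G X ∧ ∀ w, G.Adj x w → w ∈ nbhd G X ∨ w = y := by
  obtain ⟨hS, hx, hy, hxS, hc⟩ := h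
  have hSpos := hS.card_pos
  have hne : (isolated G S).Nonempty := by
    rw [← Finset.card_pos]
    nlinarith
  have hlt := hK.card_lt_nbhd hk hiso hne
  have hN : nbhd G (isolated G S) = S := by
    refine Finset.eq_of_subset_of_card_le (nbhd_isolated_subset S) ?_
    by_contra hcon
    nlinarith
  refine ⟨isolated G S, ⟨hne, by rwa [hN]⟩, fun h => hy ((mem_isolated.1 h).2 y hxy), ?_, ?_⟩
  · rwa [hN]
  · rwa [hN]

/-- Adding `v` would enlarge `X` without enlarging its neighbourhood, and a tight set has no room
for that. -/
lemma KanekoCondition.mem_of_tight (hK : KanekoCondition G k) (hk : 1 ≤ k)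
    (hiso : ∀ v, ∃ w, G.Adj v w) {X : Finset V} (hX : Tight G k X) {v : V}
    (hv : ∀ w, G.Adj v w → w ∈ nbhd G X) : v ∈ X := by
  by_contra hvX
  have h1 := hK.card_lt_nbhd hk hiso (Finset.insert_nonempty v X)
  have h2 : nbhd G (insert v X) ⊆ nbhd G X := by
    intro w hw
    obtain ⟨u, hu, huw⟩ := mem_nbhd.1 hw
    rcases Finset.mem_insert.1 hu with rfl | hu
    · exact hv w huw
    · exact mem_nbhd.2 ⟨u, hu, huw⟩
  have h3 := Finset.card_le_card h2
  rw [Finset.card_insert_of_notMem hvX] at h1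
  have h4 := hX.2
  nlinarith

/-- The excess `(k + 1)|N(X)| - |X|` is submodular, at least 1 on nonempty sets, and equal to 1
exactly on tight ones. -/
lemma KanekoCondition.tight_union (hK : KanekoCondition G k) (hk : 1 ≤ k)
    (hiso : ∀ v, ∃ w, G.Adj v w) {X Y : Finset V} (hX : Tight G k X) (hY : Tight G k Y)
    (hXY : (X ∩ Y).Nonempty) : Tight G k (X ∪ Y) := by
  refine ⟨hX.1.mono Finset.subset_union_left, ?_⟩
  have h1 := hK.card_lt_nbhd hk hiso hXY
  have h2 : nbhd G (X ∩ Y) ⊆ nbhd G X ∩ nbhd G Y :=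
    Finset.subset_inter (nbhd_mono Finset.inter_subset_left) (nbhd_mono Finset.inter_subset_right)
  have h3 := Finset.card_le_card h2
  have h4 := Finset.card_union_add_card_inter X Y
  have h5 := Finset.card_union_add_card_inter (nbhd G X) (nbhd G Y)
  have h6 := hX.2
  have h7 := hY.2
  rw [nbhd_union]
  nlinarith

/-- For disjoint `X` and `Y`, a shared neighbour would bring the excess of the union down to `2 - (k
+ 1) ≤ 0`. -/
lemma KanekoCondition.inter_nonempty_of_tight (hK : KanekoCondition G k) (hk : 1 ≤ k)
    (hiso : ∀ v, ∃ w, G.Adj v w) {X Y : Finset V} (hX : Tight G k X) (hY : Tight G k Y)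
    (hXY : (nbhd G X ∩ nbhd G Y).Nonempty) : (X ∩ Y).Nonempty := by
  by_contra hne
  rw [Finset.not_nonempty_iff_eq_empty] at hne
  have h1 := hK.card_lt_nbhd hk hiso (hX.1.mono (Finset.subset_union_left (s₂ := Y)))
  have h4 := Finset.card_union_add_card_inter X Y
  have h5 := Finset.card_union_add_card_inter (nbhd G X) (nbhd G Y)
  have h6 := hX.2
  have h7 := hY.2
  have h8 := hXY.card_pos
  rw [nbhd_union] at h1
  rw [hne, Finset.card_empty] at h4
  nlinarith

/-- If `x` is disconnected by deleting `xs`, then a tight set next to `s` extends along `s, x`. -/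
lemma KanekoCondition.tight_step (hK : KanekoCondition G k) (hk : 1 ≤ k)
    (hiso : ∀ v, ∃ w, G.Adj v w) {Z : Finset V} {r t x s s' : V} (hZ : Tight G k Z)
    (hrZ : r ∉ Z) (hrt : G.Adj r t) (htZ : t ∈ nbhd G Z) (hsZ : s ∈ nbhd G Z) (hxr : x ≠ r)
    (hxs : G.Adj x s) (hxs' : G.Adj x s') (hss' : s' ≠ s) (hD : ∃ S, Detaches G k x s S) :
    ∃ Z', Z ⊆ Z' ∧ Tight G k Z' ∧ r ∉ Z' ∧ s' ∈ nbhd G Z' := by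
  by_cases hxZ : x ∈ Z
  · exact ⟨Z, subset_rfl, hZ, hrZ, mem_nbhd.2 ⟨x, hxZ, hxs'⟩⟩
  obtain ⟨S, hS⟩ := hD
  obtain ⟨X, hX, hxX, hsX, hNx⟩ := hS.exists_tight hK hk hiso hxs
  -- If the sets met, their union would be tight with all neighbours of `x` in its neighbourhood,
  -- hence would contain `x`.
  have hdisj : ¬ (Z ∩ X).Nonempty := by
    intro h
    have hmem := hK.mem_of_tight hk hiso (hK.tight_union hk hiso hZ hX h) (v := x) (by
      intro w hw
      rw [nbhd_union, Finset.mem_union]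
      rcases hNx w hw with h | rfl
      · exact Or.inr h
      · exact Or.inl hsZ)
    rcases Finset.mem_union.1 hmem with h | h
    · exact hxZ h
    · exact hxX h
  have hNdisj : ∀ u ∈ nbhd G Z, u ∉ nbhd G X := fun u hu hu' =>
    hdisj (hK.inter_nonempty_of_tight hk hiso hZ hX ⟨u, Finset.mem_inter.2 ⟨hu, hu'⟩⟩)
  have hrX : r ∉ X := fun h => hNdisj t htZ (mem_nbhd.2 ⟨r, h, hrt⟩)
  have hs'X := (hNx s' hxs').resolve_right hss'
  -- The two excesses add up to 2, and `x`, whose neighbours are already counted, brings the total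
  -- back to 1.
  refine ⟨insert x (Z ∪ X), Finset.subset_union_left.trans (Finset.subset_insert _ _),
    ⟨Finset.insert_nonempty _ _, ?_⟩, ?_, ?_⟩
  · have hsub : nbhd G (insert x (Z ∪ X)) ⊆ nbhd G Z ∪ nbhd G X := by
      intro w hw
      obtain ⟨u, hu, huw⟩ := mem_nbhd.1 hw
      rw [Finset.mem_insert] at hu
      rcases hu with rfl | hu
      · rw [Finset.mem_union]
        rcases hNx w huw with h | rfl
        · exact Or.inr h
        · exact Or.inl hsZ
      · rw [← nbhd_union]
        exact mem_nbhd.2 ⟨u, hu, huw⟩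
    have h1 := Finset.card_le_card hsub
    have h2 := Finset.card_union_le (nbhd G Z) (nbhd G X)
    have h3 : x ∉ Z ∪ X := by simp [hxZ, hxX]
    have h4 := Finset.card_union_add_card_inter Z X
    rw [Finset.not_nonempty_iff_eq_empty.1 hdisj, Finset.card_empty] at h4
    rw [Finset.card_insert_of_notMem h3]
    have h5 := hZ.2
    have h6 := hX.2
    nlinarith
  · simp only [Finset.mem_insert, Finset.mem_union, not_or]
    exact ⟨hxr.symm, hrZ, hrX⟩
  · exact nbhd_mono (Finset.subset_union_right.trans (Finset.subset_insert _ _)) hs'X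

/-- Along a cycle `c`, the deletions of the edges at even distance cannot all isolate their later
end. -/
lemma KanekoCondition.not_forall_detaches (hK : KanekoCondition G k) (hk : 1 ≤ k)
    (hiso : ∀ v, ∃ w, G.Adj v w) {m : ℕ} (c : ZMod (m + 3) → V) (hc : Function.Injective c)
    (hadj : ∀ i, G.Adj (c i) (c (i + 1))) (a : ZMod (m + 3))
    (hD : ∀ j : ℕ, ∃ S, Detaches G k (c (a + 2 * j + 1)) (c (a + 2 * j)) S) : False := by
  have h2 : ∀ i, c (i + 2) ≠ c i := by
    intro i h
    have h := hc h
    rw [add_eq_left] at h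
    have : ((2 : ℕ) : ZMod (m + 3)) = 0 := by exact_mod_cast h
    rw [ZMod.natCast_eq_zero_iff] at this
    exact absurd (Nat.le_of_dvd (by norm_num) this) (by omega)
  have h0 := hD 0
  simp only [Nat.cast_zero, mul_zero, add_zero] at h0
  obtain ⟨S, hS⟩ := h0
  obtain ⟨X, hX, hxX, hsX, hNx⟩ := hS.exists_tight hK hk hiso (hadj a).symm
  have h22 : ∀ i, c (i + 1 + 1) ≠ c i := fun i => by
    rw [add_assoc, one_add_one_eq_two]; exact h2 i
  have hstart : c (a + 1 + 1) ∈ nbhd G X := (hNx _ (hadj _)).resolve_right (h22 a)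
  -- This is the invariant that closing the cycle will violate.
  have hret : ∀ Z, X ⊆ Z → Tight G k Z → c (a + 1) ∉ Z → c a ∉ nbhd G Z := by
    intro Z hXZ hZ hr ha
    refine hr (hK.mem_of_tight hk hiso hZ fun w hw => ?_)
    rcases hNx w hw with h | rfl
    · exact nbhd_mono hXZ h
    · exact ha
  have hind : ∀ j : ℕ, ∃ Z, X ⊆ Z ∧ Tight G k Z ∧ c (a + 1) ∉ Z ∧
      c (a + 2 * (j + 1 : ℕ)) ∈ nbhd G Z := by
    intro j
    induction j with
    | zero =>
      refine ⟨X, subset_rfl, hX, hxX, ?_⟩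
      convert hstart using 2
      push_cast
      ring
    | succ j ih =>
      obtain ⟨Z, hXZ, hZ, hr, hs⟩ := ih
      -- Reaching `c (a + 1)` here would mean that `c a` already lies in `nbhd G Z`, which `hret`
      -- excludes.
      have hne : c (a + 2 * (j + 1 : ℕ) + 1) ≠ c (a + 1) := by
        intro h
        have h := add_right_cancel (hc h)
        rw [h] at hs
        exact hret Z hXZ hZ hr hs
      obtain ⟨Z', hZZ', hZ', hr', hs'⟩ := hK.tight_step hk hiso hZ hr (hadj _)
        (nbhd_mono hXZ hstart) hs hne (hadj _).symm (hadj _) (h22 _) (hD (j + 1))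
      refine ⟨Z', hXZ.trans hZZ', hZ', hr', ?_⟩
      convert hs' using 2
      push_cast
      ring
  -- After `m + 3` steps of two the walk is back at `c a`, whatever the parity of the length.
  obtain ⟨Z, hXZ, hZ, hr, hs⟩ := hind (m + 2)
  refine hret Z hXZ hZ hr ?_
  have : ((m + 2 + 1 : ℕ) : ZMod (m + 3)) = 0 := ZMod.natCast_self (m + 3)
  rwa [this, mul_zero, add_zero] at hs

end

/-! ### Cycles indexed by `ZMod (m + 3)` -/

lemma natCast_zmod_add_three_eq {m i j : ℕ} (hi : i < m + 3) (hj : j < m + 3)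
    (h : (i : ZMod (m + 3)) = j) : i = j := by
  rw [ZMod.natCast_eq_natCast_iff'] at h
  rwa [Nat.mod_eq_of_lt hi, Nat.mod_eq_of_lt hj] at h

/-- Deleting an edge of a cycle preserves connectedness. -/
lemma connected_sdiff_edge_of_cycle {V : Type*} {G : SimpleGraph V}
    (hconn : G.Connected) {m : ℕ} (c : ZMod (m + 3) → V) (hc : Function.Injective c)
    (hadj : ∀ i, G.Adj (c i) (c (i + 1))) (i : ZMod (m + 3)) :
    (G \ SimpleGraph.edge (c i) (c (i + 1))).Connected := by
  refine hconn.connected_delete_edge_of_not_isBridge (x := c i) (y := c (i + 1)) ?_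
  rw [SimpleGraph.isBridge_iff, not_not]
  have hreach : ∀ t : ℕ, t < m + 3 →
      (G.deleteEdges {s(c i, c (i + 1))}).Reachable (c (i + 1)) (c (i + 1 + t)) := by
    intro t
    induction t with
    | zero => intro _; simp
    | succ t ih =>
      intro ht
      refine (ih (by omega)).trans (SimpleGraph.Adj.reachable ?_)
      rw [SimpleGraph.deleteEdges_adj]
      push_cast
      rw [← add_assoc]
      refine ⟨hadj _, fun h => ?_⟩
      simp only [Set.mem_singleton_iff, Sym2.eq_iff] at h
      rcases h with ⟨h, -⟩ | ⟨h, h'⟩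
      · have h := hc h
        have : ((t + 1 : ℕ) : ZMod (m + 3)) = (0 : ℕ) := by
          push_cast
          linear_combination h
        have := natCast_zmod_add_three_eq ht (by omega) this
        omega
      · have h := hc h
        have h' := hc h'
        have : ((2 : ℕ) : ZMod (m + 3)) = (0 : ℕ) := by
          push_cast
          linear_combination h' - h
        have := natCast_zmod_add_three_eq (by omega) (by omega) this
        omega
  have := hreach (m + 2) (by omega)
  have hlast : i + 1 + ((m + 2 : ℕ) : ZMod (m + 3)) = i := by
    have : ((m + 3 : ℕ) : ZMod (m + 3)) = 0 := ZMod.natCast_self (m + 3)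
    push_cast at this ⊢
    linear_combination this
  rw [hlast] at this
  exact this.symm

/-- The index type is definitionally `Fin (m + 3)`, the vertex type of the cycle graph, and its
successor wraps around. -/
lemma exists_cycle_of_not_isAcyclic {V : Type*} {G : SimpleGraph V} (h : ¬ G.IsAcyclic) :
    ∃ (m : ℕ) (c : ZMod (m + 3) → V), Function.Injective c ∧ ∀ i, G.Adj (c i) (c (i + 1)) := by
  rw [SimpleGraph.isAcyclic_iff_free_cycleGraph] at h
  push Not at h
  obtain ⟨n, hn, hfree⟩ := h
  obtain ⟨m, rfl⟩ := Nat.exists_eq_add_of_le' hn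
  obtain ⟨f⟩ := hfree
  refine ⟨m, fun i => f.toHom (show Fin (m + 3) from i), f.injective, fun i => f.toHom.map_adj ?_⟩
  rw [SimpleGraph.cycleGraph_adj]
  right
  exact add_sub_cancel_left (G := ZMod (m + 3)) i 1

/-! ### Kaneko's theorem -/

section

open scoped Classical

variable {V : Type*} [Fintype V] {G : SimpleGraph V} {k : ℕ}

/-- In a connected graph on at least four vertices with Kaneko's condition, the deletion of some
edge of any given cycle keeps the condition. -/
lemma KanekoCondition.exists_edge_of_cycle (hK : KanekoCondition G k) (hk : 1 ≤ k)
    (hconn : G.Connected) (hcard : 4 ≤ Fintype.card V) (hiso : ∀ v, ∃ w, G.Adj v w)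
    {m : ℕ} (c : ZMod (m + 3) → V) (hc : Function.Injective c)
    (hadj : ∀ i, G.Adj (c i) (c (i + 1))) :
    ∃ i, KanekoCondition (G \ SimpleGraph.edge (c i) (c (i + 1))) k := by
  by_contra! hcon
  have h22 : ∀ {m : ℕ} (c : ZMod (m + 3) → V), Function.Injective c →
      ∀ i, c (i + 1 + 1) ≠ c i := by
    intro m c hc i h
    have h := hc h
    have : ((2 : ℕ) : ZMod (m + 3)) = (0 : ℕ) := by
      push_cast
      linear_combination h
    have := natCast_zmod_add_three_eq (by omega) (by omega) this
    omega
  -- An obstruction isolating the later end of one edge propagates to every second edge, which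
  -- `not_forall_detaches` forbids.
  have main : ∀ c : ZMod (m + 3) → V, Function.Injective c → (∀ i, G.Adj (c i) (c (i + 1))) →
      (∀ i, ¬ KanekoCondition (G \ SimpleGraph.edge (c i) (c (i + 1))) k) → ∀ i,
      ¬ ((∃ S, Detaches G k (c (i + 1)) (c i) S) ∨ ∃ S, DetachesBoth G k (c (i + 1)) (c i) S) := by
    intro c hc hadj hcon i hQ
    have hstep : ∀ i, ((∃ S, Detaches G k (c (i + 1)) (c i) S) ∨
        ∃ S, DetachesBoth G k (c (i + 1)) (c i) S) →
        ∃ S, Detaches G k (c (i + 2 + 1)) (c (i + 2)) S := by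
      intro i hQ
      have e : i + 2 = i + 1 + 1 := by ring
      rw [e]
      refine hK.detaches_next hk hconn hcard hiso (h22 c hc i) (h22 c hc (i + 1)) (hadj i).symm
        (hadj (i + 1)) (hadj (i + 1 + 1)) ⟨c (i - 1), ?_, ?_⟩
        ⟨c (i + 1 + 1 + 1 + 1), hadj _, h22 c hc _⟩ hQ (hcon _)
      · simpa using (hadj (i - 1)).symm
      · have := h22 c hc (i - 1)
        rw [sub_add_cancel] at this
        exact this.symm
    refine hK.not_forall_detaches hk hiso c hc hadj (i + 2) fun j => ?_
    induction j with
    | zero => simpa using hstep i hQ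
    | succ j ih =>
      have := hstep _ (Or.inl ih)
      have e : i + 2 + 2 * ((j + 1 : ℕ) : ZMod (m + 3)) = i + 2 + 2 * j + 2 := by
        push_cast
        ring
      rwa [e]
  -- Reversing the cycle excludes obstructions at the other end, so none of the three kinds is left
  -- for the edge from `c 0` to `c 1`.
  have hrev := main (fun i => c (-i)) (fun i j h => neg_injective (hc h))
    (fun i => by
      have := (hadj (-(i + 1))).symm
      rwa [show -(i + 1) + 1 = -i by ring] at this)
    (fun i => by
      have := hcon (-(i + 1))
      rwa [show -(i + 1) + 1 = -i by ring, SimpleGraph.edge_comm] at this) (-1)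
  have hfwd := main c hc hadj hcon 0
  simp only [neg_neg, neg_add_cancel, neg_zero] at hrev
  rw [zero_add] at hfwd
  have h0 := hcon 0
  rw [zero_add] at h0
  rcases hK.exists_detaches h0 with h | h | h
  · exact hrev (Or.inl h)
  · exact hfwd (Or.inl h)
  · exact hrev (Or.inr h)

/-- Kaneko's theorem, the sufficiency part: a connected graph on at least four vertices satisfying
Kaneko's condition has a spanning tree with leaf degree at most `k`. -/
theorem KanekoCondition.exists_spanningTree (hK : KanekoCondition G k) (hk : 1 ≤ k)
    (hconn : G.Connected) (hcard : 4 ≤ Fintype.card V) :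
    ∃ T : SimpleGraph V, IsSpanningTree T G ∧ leafDegree T ≤ k := by
  obtain ⟨H, ⟨hHG, hHconn, hHK⟩, hmin⟩ :=
    (Set.toFinite {H : SimpleGraph V | H ≤ G ∧ H.Connected ∧ KanekoCondition H k}).exists_minimal
      ⟨G, le_rfl, hconn, hK⟩
  have : Nontrivial V := Fintype.one_lt_card_iff_nontrivial.1 (by omega)
  have hiso : ∀ v, ∃ w, H.Adj v w := fun v => hHconn.preconnected.exists_adj_of_nontrivial v
  refine ⟨H, ⟨hHG, hHconn, ?_⟩, ?_⟩
  · by_contra hcyc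
    obtain ⟨m, c, hc, hadj⟩ := exists_cycle_of_not_isAcyclic hcyc
    obtain ⟨i, hi⟩ := hHK.exists_edge_of_cycle hk hHconn hcard hiso c hc hadj
    have hle : H \ SimpleGraph.edge (c i) (c (i + 1)) ≤ H := sdiff_le
    have := hmin ⟨hle.trans hHG, connected_sdiff_edge_of_cycle hHconn c hc hadj i, hi⟩ hle
    have h := this (hadj i)
    rw [SimpleGraph.sdiff_adj, SimpleGraph.edge_adj] at h
    exact h.2 ⟨Or.inl ⟨rfl, rfl⟩, (hadj i).ne⟩
  · refine Finset.sup_le fun v _ => ?_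
    rcases Finset.eq_empty_or_nonempty
      (Finset.univ.filter fun u : V => H.Adj v u ∧ H.degree u = 1) with h | h
    · rw [h]
      simp
    · have h1 := hHK.card_lt_nbhd hk hiso h
      have h2 : nbhd H (Finset.univ.filter fun u : V => H.Adj v u ∧ H.degree u = 1) ⊆ {v} := by
        intro w hw
        obtain ⟨u, hu, huw⟩ := mem_nbhd.1 hw
        simp only [Finset.mem_filter, Finset.mem_univ, true_and] at hu
        obtain ⟨x, hx⟩ := Finset.card_eq_one.1 ((H.card_neighborFinset_eq_degree u).trans hu.2)
        have hv : v ∈ H.neighborFinset u := by simpa using hu.1.symm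
        have hw : w ∈ H.neighborFinset u := by simpa using huw
        rw [hx, Finset.mem_singleton] at hv hw
        simp [hv, hw]
      have h3 := Finset.card_le_card h2
      rw [Finset.card_singleton] at h3
      have h4 := h1.trans_le (Nat.mul_le_mul_left (k + 1) h3)
      omega

end

/-! ### Rayleigh, Perron and Collatz–Wielandt bounds -/

section

open scoped Classical
open Matrix

/-- The Rayleigh bound for a real symmetric matrix, in the form of positive semidefiniteness. -/
lemma posSemidef_iSup_eigenvalues_sub {V : Type*} [Fintype V] {A : Matrix V V ℝ}
    (hA : A.IsHermitian) :
    (algebraMap ℝ (Matrix V V ℝ) (⨆ i, hA.eigenvalues i) - A).PosSemidef := by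
  set L := ⨆ i, hA.eigenvalues i
  have hB : (algebraMap ℝ (Matrix V V ℝ) L - A).IsHermitian := by
    refine IsHermitian.sub ?_ hA
    rw [algebraMap_eq_diagonal]
    exact isHermitian_diagonal _
  rw [hB.posSemidef_iff_eigenvalues_nonneg]
  intro j
  have hmem := hB.eigenvalues_mem_spectrum_real j
  rw [← spectrum.singleton_sub_eq, hA.spectrum_real_eq_range_eigenvalues] at hmem
  obtain ⟨l, hl, μ, ⟨i, rfl⟩, h⟩ := hmem
  rw [Set.mem_singleton_iff] at hl
  subst hl
  have : hA.eigenvalues i ≤ L := le_ciSup (Finite.bddAbove_range _) i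
  simp only [Pi.zero_apply]
  rw [← h]
  simpa using this

variable {V : Type*} [Fintype V] (G : SimpleGraph V)

lemma dotProduct_adjMatrix_mulVec_eq (x : V → ℝ) :
    x ⬝ᵥ (G.adjMatrix ℝ *ᵥ x) = ∑ v, ∑ w, if G.Adj v w then x v * x w else 0 := by
  simp only [dotProduct, mulVec, SimpleGraph.adjMatrix_apply, Finset.mul_sum]
  refine Finset.sum_congr rfl fun v _ => Finset.sum_congr rfl fun w _ => ?_
  split_ifs <;> simp

lemma sub_mulVec_lambdaOne (x : V → ℝ) :
    (algebraMap ℝ (Matrix V V ℝ) (lambdaOne G) - G.adjMatrix ℝ) *ᵥ x =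
      lambdaOne G • x - G.adjMatrix ℝ *ᵥ x := by
  rw [sub_mulVec, Algebra.algebraMap_eq_smul_one, smul_mulVec, one_mulVec]

/-- The quadratic form of the adjacency matrix is bounded by `λ₁`. -/
lemma quadraticForm_le_lambdaOne (x : V → ℝ) :
    ∑ v, ∑ w, (if G.Adj v w then x v * x w else 0) ≤ lambdaOne G * ∑ v, x v ^ 2 := by
  have h := (posSemidef_iSup_eigenvalues_sub (G.isHermitian_adjMatrix ℝ)).dotProduct_mulVec_nonneg x
  change 0 ≤ star x ⬝ᵥ
    ((algebraMap ℝ (Matrix V V ℝ) (lambdaOne G) - G.adjMatrix ℝ) *ᵥ x) at h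
  rw [sub_mulVec_lambdaOne, dotProduct_sub, dotProduct_smul, star_trivial,
    dotProduct_adjMatrix_mulVec_eq] at h
  have e : x ⬝ᵥ x = ∑ v, x v ^ 2 := by
    simp [dotProduct, sq]
  rw [e, smul_eq_mul] at h
  linarith

variable {G}

/-- A connected graph has a positive eigenvector for `λ₁`. -/
lemma exists_perron_vector (hconn : G.Connected) :
    ∃ u : V → ℝ, (∀ v, 0 < u v) ∧
      ∀ v, ∑ w, (if G.Adj v w then u w else 0) = lambdaOne G * u v := by
  have hne : Nonempty V := hconn.nonempty
  set hA := G.isHermitian_adjMatrix ℝ with hAdef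
  obtain ⟨i, hi⟩ := Finite.exists_max hA.eigenvalues
  have hL : hA.eigenvalues i = lambdaOne G :=
    le_antisymm (le_ciSup (Finite.bddAbove_range hA.eigenvalues) i) (ciSup_le hi)
  set z : V → ℝ := ⇑(hA.eigenvectorBasis i) with hz
  have hz0 : z ≠ 0 := by
    intro h
    refine hA.eigenvectorBasis.toBasis.ne_zero i ?_
    ext v
    simpa using congrFun h v
  have hzA : G.adjMatrix ℝ *ᵥ z = lambdaOne G • z := by
    rw [← hL]
    exact hA.mulVec_eigenvectorBasis i
  set u : V → ℝ := fun v => |z v| with hu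
  have hu0 : ∀ v, 0 ≤ u v := fun v => abs_nonneg _
  have hsq : ∑ v, u v ^ 2 = ∑ v, z v ^ 2 := by simp [hu]
  -- Absolute values cannot lower the quadratic form, so `|z|` attains the Rayleigh maximum too.
  have hquad : lambdaOne G * ∑ v, u v ^ 2 = ∑ v, ∑ w, if G.Adj v w then u v * u w else 0 := by
    refine le_antisymm ?_ (quadraticForm_le_lambdaOne G u)
    have h1 : lambdaOne G * ∑ v, z v ^ 2 = ∑ v, ∑ w, if G.Adj v w then z v * z w else 0 := by
      rw [← dotProduct_adjMatrix_mulVec_eq, hzA, dotProduct_smul, smul_eq_mul]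
      simp [dotProduct, sq]
    rw [hsq, h1]
    refine Finset.sum_le_sum fun v _ => Finset.sum_le_sum fun w _ => ?_
    split_ifs
    · rw [hu, ← abs_mul]
      exact le_abs_self _
    · rfl
  -- A null vector of the positive semidefinite form of `λ₁ - A` lies in the kernel.
  have huA : G.adjMatrix ℝ *ᵥ u = lambdaOne G • u := by
    have hps := posSemidef_iSup_eigenvalues_sub hA
    have h0 : star u ⬝ᵥ
        ((algebraMap ℝ (Matrix V V ℝ) (lambdaOne G) - G.adjMatrix ℝ) *ᵥ u) = 0 := by
      rw [sub_mulVec_lambdaOne, dotProduct_sub, dotProduct_smul, star_trivial,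
        dotProduct_adjMatrix_mulVec_eq, ← hquad]
      simp [dotProduct, sq]
    have h1 := (hps.dotProduct_mulVec_zero_iff u).1 h0
    change (algebraMap ℝ (Matrix V V ℝ) (lambdaOne G) - G.adjMatrix ℝ) *ᵥ u = 0 at h1
    rw [sub_mulVec_lambdaOne, sub_eq_zero] at h1
    exact h1.symm
  have heig : ∀ v, ∑ w, (if G.Adj v w then u w else 0) = lambdaOne G * u v := by
    intro v
    have := congrFun huA v
    simpa [mulVec, dotProduct, SimpleGraph.adjMatrix_apply] using this
  refine ⟨u, fun v => (hu0 v).lt_of_ne' fun hv => hz0 ?_, heig⟩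
  -- A zero of `u` spreads along edges to the whole connected graph.
  have hstep : ∀ a b, G.Adj a b → u a = 0 → u b = 0 := by
    intro a b hab ha
    have h := heig a
    rw [ha, mul_zero, Finset.sum_eq_zero_iff_of_nonneg] at h
    · simpa [hab] using h b (Finset.mem_univ b)
    · intro w _
      split_ifs
      · exact hu0 w
      · exact le_rfl
  funext b
  obtain ⟨p⟩ := hconn.preconnected v b
  have : u b = 0 := by
    induction p with
    | nil => exact hv
    | cons h p ih => exact ih (hstep _ _ h hv)
  exact abs_eq_zero.1 this

/-- A proper spanning subgraph relation with a connected graph makes `λ₁` strictly larger; the two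
graphs are compared along a bijection of their vertices. -/
lemma lambdaOne_lt_of_embedding {W : Type*} [Fintype W] {H : SimpleGraph W} (hconn : G.Connected)
    (e : V ≃ W) (hle : ∀ v w, G.Adj v w → H.Adj (e v) (e w))
    (hne : ∃ v w, ¬ G.Adj v w ∧ H.Adj (e v) (e w)) : lambdaOne G < lambdaOne H := by
  obtain ⟨u, hu, heig⟩ := exists_perron_vector hconn
  obtain ⟨a, b, hab, hab'⟩ := hne
  -- The Perron vector of `G` is the trial vector for `H`; being positive, it gains strictly from
  -- the extra edge.
  have h1 := quadraticForm_le_lambdaOne H (u ∘ e.symm)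
  have h2 : ∑ v, (u ∘ e.symm) v ^ 2 = ∑ v, u v ^ 2 := by
    rw [← e.sum_comp]
    simp
  have h3 : ∑ v, ∑ w, (if H.Adj v w then (u ∘ e.symm) v * (u ∘ e.symm) w else 0) =
      ∑ v, ∑ w, if H.Adj (e v) (e w) then u v * u w else 0 := by
    rw [← e.sum_comp]
    refine Finset.sum_congr rfl fun v _ => ?_
    rw [← e.sum_comp]
    simp
  have h4 : lambdaOne G * ∑ v, u v ^ 2 = ∑ v, ∑ w, if G.Adj v w then u v * u w else 0 := by
    rw [Finset.mul_sum]
    refine Finset.sum_congr rfl fun v _ => ?_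
    rw [sq, ← mul_assoc, ← heig v, Finset.sum_mul]
    refine Finset.sum_congr rfl fun w _ => ?_
    split_ifs <;> ring
  have hterm : ∀ v w, (if G.Adj v w then u v * u w else 0) ≤
      if H.Adj (e v) (e w) then u v * u w else 0 := by
    intro v w
    have := mul_pos (hu v) (hu w)
    by_cases h : G.Adj v w
    · simp [h, hle v w h]
    · rw [if_neg h]
      split_ifs <;> linarith
  have h5 : ∑ v, ∑ w, (if G.Adj v w then u v * u w else 0) <
      ∑ v, ∑ w, if H.Adj (e v) (e w) then u v * u w else 0 := by
    refine Finset.sum_lt_sum (fun v _ => Finset.sum_le_sum fun w _ => hterm v w)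
      ⟨a, Finset.mem_univ a, Finset.sum_lt_sum (fun w _ => hterm a w) ⟨b, Finset.mem_univ b, ?_⟩⟩
    rw [if_neg hab, if_pos hab']
    exact mul_pos (hu a) (hu b)
  have hpos : 0 < ∑ v, u v ^ 2 :=
    Finset.sum_pos (fun v _ => pow_pos (hu v) 2) ⟨a, Finset.mem_univ a⟩
  rw [h2, h3] at h1
  rw [← h4] at h5
  exact lt_of_mul_lt_mul_right (h5.trans_le h1) hpos.le

/-- The Collatz–Wielandt bound with a strict inequality at one vertex. -/
lemma lambdaOne_lt_of_test_vector (hconn : G.Connected) {x : V → ℝ} {L : ℝ} (hx : ∀ v, 0 ≤ x v)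
    (hle : ∀ v, ∑ w, (if G.Adj v w then x w else 0) ≤ L * x v) {a : V} (ha : 0 < x a)
    (hlt : ∑ w, (if G.Adj a w then x w else 0) < L * x a) : lambdaOne G < L := by
  obtain ⟨u, hu, heig⟩ := exists_perron_vector hconn
  -- Pair the row inequalities with the Perron vector: its positivity makes one strict row enough.
  have h1 : ∑ v, u v * ∑ w, (if G.Adj v w then x w else 0) = lambdaOne G * ∑ v, u v * x v := by
    simp only [Finset.mul_sum]
    rw [Finset.sum_comm]
    refine Finset.sum_congr rfl fun w _ => ?_
    rw [← mul_assoc, ← heig w, Finset.sum_mul]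
    refine Finset.sum_congr rfl fun v _ => ?_
    simp only [G.adj_comm w v]
    split_ifs <;> ring
  have h2 : ∑ v, u v * ∑ w, (if G.Adj v w then x w else 0) < ∑ v, u v * (L * x v) :=
    Finset.sum_lt_sum (fun v _ => mul_le_mul_of_nonneg_left (hle v) (hu v).le)
      ⟨a, Finset.mem_univ a, mul_lt_mul_of_pos_left hlt (hu a)⟩
  have h3 : ∑ v, u v * (L * x v) = L * ∑ v, u v * x v := by
    rw [Finset.mul_sum]
    exact Finset.sum_congr rfl fun v _ => by ring
  have hpos : 0 < ∑ v, u v * x v :=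
    Finset.sum_pos' (fun v _ => mul_nonneg (hu v).le (hx v))
      ⟨a, Finset.mem_univ a, mul_pos (hu a) ha⟩
  rw [h1, h3] at h2
  exact lt_of_mul_lt_mul_right h2 hpos.le

end

/-! ### Bounds on either side of `n - k - 2` -/

section

open scoped Classical

/-- A clique `C` forces `λ₁ ≥ |C| - 1`. -/
lemma card_sub_one_le_lambdaOne {W : Type*} [Fintype W] (H : SimpleGraph W) {C : Finset W}
    (hC : C.Nonempty) (hadj : ∀ v ∈ C, ∀ w ∈ C, v ≠ w → H.Adj v w) :
    (C.card : ℝ) - 1 ≤ lambdaOne H := by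
  have h := quadraticForm_le_lambdaOne H fun v => if v ∈ C then 1 else 0
  have h1 : ∑ v, (if v ∈ C then (1 : ℝ) else 0) ^ 2 = C.card := by simp
  have h2 : ∀ v ∈ C, ((C.card : ℝ) - 1) ≤ ∑ w, (if H.Adj v w then
      (if v ∈ C then (1 : ℝ) else 0) * (if w ∈ C then 1 else 0) else 0) := by
    intro v hv
    have h3 : ((C.erase v).card : ℝ) = ∑ w, if w ∈ C.erase v then (1 : ℝ) else 0 := by
      rw [Finset.sum_boole, Finset.filter_univ_mem]
    have h4 := Finset.card_erase_add_one hv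
    have h5 : ((C.erase v).card : ℝ) + 1 = C.card := by exact_mod_cast h4
    rw [← h5, add_sub_cancel_right, h3]
    refine Finset.sum_le_sum fun w _ => ?_
    by_cases hw : w ∈ C.erase v
    · obtain ⟨hwv, hwC⟩ := Finset.mem_erase.1 hw
      simp [hwC, hv, hadj v hv w hwC hwv.symm, hwv]
    · rw [if_neg hw]
      positivity
  have h3 : (C.card : ℝ) * ((C.card : ℝ) - 1) ≤ ∑ v, ∑ w, (if H.Adj v w then
      (if v ∈ C then (1 : ℝ) else 0) * (if w ∈ C then 1 else 0) else 0) := by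
    rw [← nsmul_eq_mul, ← Finset.sum_const]
    refine (Finset.sum_le_sum h2).trans
      (Finset.sum_le_sum_of_subset_of_nonneg (Finset.subset_univ C) fun v _ _ => ?_)
    positivity
  rw [h1] at h
  have hpos : (0 : ℝ) < C.card := by exact_mod_cast hC.card_pos
  nlinarith

/-- The centre and the large clique together form a clique on `n - k - 1` vertices. -/
lemma le_lambdaOne_extremalGraph {n k : ℕ} (hn : k + 2 ≤ n) :
    (n : ℝ) - k - 2 ≤ lambdaOne (extremalGraph n k) := by
  have h := card_sub_one_le_lambdaOne (extremalGraph n k)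
    (C := Finset.univ.disjSum (Finset.univ.disjSum ∅)) ⟨Sum.inl 0, by simp⟩ (by
      rintro (a | a | a) ha (b | b | b) hb hab
      · exact absurd (congrArg Sum.inl (Subsingleton.elim a b)) hab
      · trivial
      · trivial
      · trivial
      · change a ≠ b
        rintro rfl
        exact hab rfl
      · simp at hb
      · trivial
      · simp at ha
      · simp at ha)
  have hc : ((n - (k + 2) : ℕ) : ℝ) = n - (k + 2) := by
    rw [Nat.cast_sub hn]
    push_cast
    ring
  simp only [Finset.card_disjSum, Finset.card_univ, Fintype.card_fin, Finset.card_empty,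
    Nat.cast_add, hc] at h
  push_cast at h
  linarith

/-- The numerical inequality behind the comparison with the test vector, with `K = k + 2`,
`q = s - 1`. -/
lemma test_vector_ineq {K q m L : ℝ} (hK : 3 ≤ K) (hq : q = 1 ∨ 2 ≤ q) (hm : 0 ≤ m)
    (hL : L = m + K * q) (hLK : K + 8 ≤ L) :
    q + m * ((q + 1) / (K * q + 1)) + (K - 1) * (q + 1) * ((q + 1) / L) < L := by
  have hq1 : 1 ≤ q := by rcases hq with h | h <;> linarith
  have hL0 : 0 < L := by linarith
  have hb : (q + 1) / (K * q + 1) ≤ 1 / 2 := by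
    rw [div_le_div_iff₀ (by nlinarith) (by norm_num)]
    nlinarith
  have hmb := mul_le_mul_of_nonneg_left hb hm
  suffices h : (K - 1) * (q + 1) * ((q + 1) / L) < L - q - m / 2 by linarith
  rw [mul_div_assoc', div_lt_iff₀ hL0]
  have hexp : (L - q - m / 2) * L = (m / 2 + (K - 1) * q) * (m + K * q) := by
    rw [hL]
    ring
  rw [hexp]
  -- For `q ≥ 2` it suffices that `(q + 1)² < K q²`. At `q = 1` this fails for `K ≤ 4`, and `m ≥ 8`
  -- takes over.
  rcases hq with rfl | hq2
  · have hm8 : 8 ≤ m := by linarith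
    nlinarith [mul_nonneg (sub_nonneg.2 hm8) (sub_nonneg.2 hK)]
  · have h1 : (K - 1) * q * (K * q) ≤ (m / 2 + (K - 1) * q) * (m + K * q) :=
      mul_le_mul (by linarith) (by linarith) (by nlinarith) (by nlinarith)
    have h2 : (q + 1) * (q + 1) < q * (K * q) := by
      nlinarith [mul_nonneg (sub_nonneg.2 hK) (mul_self_nonneg q)]
    have h3 := mul_lt_mul_of_pos_left h2 (by linarith : 0 < K - 1)
    nlinarith

/-- Spectral bound when at least two vertices isolate `(k + 1) |S|` others. -/
lemma lambdaOne_lt_of_isolated {V : Type*} [Fintype V] {G : SimpleGraph V} {n k : ℕ}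
    (hG : G.Connected) (hcard : Fintype.card V = n) (hk : 1 ≤ k) (hn : 2 * k + 12 ≤ n)
    {S I : Finset V} (hI : I ⊆ isolated G S) (hIcard : I.card = (k + 1) * S.card)
    (hS : 2 ≤ S.card) : lambdaOne G < (n : ℝ) - k - 2 := by
  have hdisj : Disjoint S I := Finset.disjoint_right.2 fun v hv => (mem_isolated.1 (hI hv)).1
  set R := (S ∪ I)ᶜ with hR
  have hRcard : S.card + I.card + R.card = n := by
    rw [← Finset.card_union_of_disjoint hdisj, hR, Finset.card_add_card_compl, hcard]
  obtain ⟨q, hq⟩ : ∃ q : ℕ, S.card = q + 1 := ⟨S.card - 1, by omega⟩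
  have hnR : (n : ℝ) = (q + 1) + (k + 1) * (q + 1) + R.card := by
    rw [← hRcard, hIcard, hq]
    push_cast
    ring
  set L : ℝ := (n : ℝ) - k - 2 with hL
  have hn' : (2 : ℝ) * k + 12 ≤ n := by exact_mod_cast hn
  have hk' : (1 : ℝ) ≤ k := by exact_mod_cast hk
  have hLm : L = R.card + ((k : ℝ) + 2) * q := by
    rw [hL, hnR]
    ring
  have hq' : (q : ℝ) = 1 ∨ (2 : ℝ) ≤ q := by
    have : q = 1 ∨ 2 ≤ q := by omega
    rcases this with h | h
    · left; exact_mod_cast h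
    · right; exact_mod_cast h
  -- With `K = k + 2`, the assumption `n ≥ 2k + 12` is exactly `K + 8 ≤ L`.
  have hineq := test_vector_ineq (K := (k : ℝ) + 2) (q := q) (m := R.card) (L := L) (by linarith)
    hq' (by positivity) hLm (by linarith)
  have hL0 : 0 < L := by linarith
  have hD0 : (0 : ℝ) < ((k : ℝ) + 2) * q + 1 := by positivity
  -- The weights solve `L c = |S|` and `(L - |R| + 1) b = |S|`: the rows over `I` and `R` are then
  -- equalities when all possible edges are present, and the strict inequality is left to `S`.
  set b : ℝ := ((q : ℝ) + 1) / (((k : ℝ) + 2) * q + 1) with hb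
  set c : ℝ := ((q : ℝ) + 1) / L with hc
  have hb0 : 0 ≤ b := by positivity
  have hc0 : 0 ≤ c := by positivity
  have hLc : L * c = q + 1 := mul_div_cancel₀ _ hL0.ne'
  have hLb : L * b = (q + 1) + R.card * b - b := by
    have : (((k : ℝ) + 2) * q + 1) * b = q + 1 := mul_div_cancel₀ _ hD0.ne'
    rw [hLm]
    linarith
  set x : V → ℝ := fun v => if v ∈ S then 1 else if v ∈ I then c else b with hx
  have hx0 : ∀ v, 0 ≤ x v := by
    intro v
    simp only [hx]
    split_ifs <;> first | exact zero_le_one | assumption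
  have hxS : ∀ v ∈ S, x v = 1 := fun v hv => by simp [hx, hv]
  have hxI : ∀ v ∈ I, x v = c := fun v hv => by
    simp [hx, hv, Finset.disjoint_right.1 hdisj hv]
  have hxR : ∀ v ∈ R, x v = b := fun v hv => by
    simp only [hR, Finset.mem_compl, Finset.mem_union, not_or] at hv
    simp [hx, hv.1, hv.2]
  have hsum : ∀ f : V → ℝ, ∑ v, f v = ∑ v ∈ S, f v + ∑ v ∈ I, f v + ∑ v ∈ R, f v := by
    intro f
    rw [← Finset.sum_union hdisj, hR, Finset.sum_add_sum_compl]
  have hSsum : ∑ v ∈ S, x v = q + 1 := by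
    rw [Finset.sum_congr rfl hxS, Finset.sum_const, hq]
    simp
  have hIsum : ∑ v ∈ I, x v = ((k : ℝ) + 1) * (q + 1) * c := by
    rw [Finset.sum_congr rfl hxI, Finset.sum_const, hIcard, hq]
    simp
  have hRsum : ∑ v ∈ R, x v = R.card * b := by
    rw [Finset.sum_congr rfl hxR, Finset.sum_const]
    simp
  have hdiag : ∀ (f : V → ℝ) (v : V), ∑ w, (if w = v then 0 else f w) = ∑ w, f w - f v := by
    intro f v
    rw [← Finset.add_sum_erase _ f (Finset.mem_univ v),
      ← Finset.add_sum_erase _ (fun w => if w = v then 0 else f w) (Finset.mem_univ v)]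
    simp only [if_true, zero_add, add_sub_cancel_left]
    exact Finset.sum_congr rfl fun w hw => if_neg (Finset.ne_of_mem_erase hw)
  have hrowS : ∀ v ∈ S, ∑ w, (if G.Adj v w then x w else 0) < L * x v := by
    intro v hv
    have h1 : ∑ w, (if G.Adj v w then x w else 0) ≤ ∑ w, (if w = v then 0 else x w) := by
      refine Finset.sum_le_sum fun w _ => ?_
      by_cases hvw : G.Adj v w
      · simp [hvw, hvw.ne']
      · rw [if_neg hvw]
        split_ifs
        · rfl
        · exact hx0 w
    rw [hdiag, hsum x, hSsum, hIsum, hRsum, hxS v hv] at h1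
    rw [hxS v hv]
    linarith
  obtain ⟨a, ha⟩ : S.Nonempty := Finset.card_pos.1 (by omega)
  refine lambdaOne_lt_of_test_vector hG hx0 (fun v => ?_) (by rw [hxS a ha]; exact one_pos)
    (hrowS a ha)
  by_cases hvS : v ∈ S
  · exact (hrowS v hvS).le
  by_cases hvI : v ∈ I
  · rw [hxI v hvI, hLc, ← hSsum, Finset.sum_ite, Finset.sum_const_zero, add_zero]
    refine Finset.sum_le_sum_of_subset_of_nonneg (fun w hw => ?_) fun w _ _ => hx0 w
    exact (mem_isolated.1 (hI hvI)).2 w (Finset.mem_filter.1 hw).2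
  · have hvR : v ∈ R := by simp [hR, hvS, hvI]
    have h1 : ∑ w, (if G.Adj v w then x w else 0) ≤
        ∑ w, (if w = v then 0 else if w ∈ I then 0 else x w) := by
      refine Finset.sum_le_sum fun w _ => ?_
      by_cases hvw : G.Adj v w
      · have hwI : w ∉ I := fun h => hvS ((mem_isolated.1 (hI h)).2 v hvw.symm)
        simp [hvw, hvw.ne', hwI]
      · rw [if_neg hvw]
        split_ifs
        · rfl
        · rfl
        · exact hx0 w
    rw [hdiag, hsum (fun w => if w ∈ I then 0 else x w), if_neg hvI, hxR v hvR] at h1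
    have e1 : ∑ w ∈ S, (if w ∈ I then 0 else x w) = q + 1 := by
      rw [← hSsum]
      exact Finset.sum_congr rfl fun w hw => if_neg (Finset.disjoint_left.1 hdisj hw)
    have e2 : ∑ w ∈ I, (if w ∈ I then 0 else x w) = 0 :=
      Finset.sum_eq_zero fun w hw => if_pos hw
    have e3 : ∑ w ∈ R, (if w ∈ I then 0 else x w) = R.card * b := by
      rw [← hRsum]
      refine Finset.sum_congr rfl fun w hw => if_neg fun h => ?_
      simp only [hR, Finset.mem_compl, Finset.mem_union, not_or] at hw
      exact hw.2 h
    rw [e1, e2, e3] at h1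
    rw [hxR v hvR, hLb]
    linarith

/-! ### Comparison with the extremal graph -/

lemma exists_equiv_of_card_fiber {α β γ : Type*} [Fintype α] [Fintype β] (f : α → γ) (g : β → γ)
    (h : ∀ y, Fintype.card {x // f x = y} = Fintype.card {x // g x = y}) :
    ∃ e : α ≃ β, ∀ x, g (e x) = f x := by
  refine ⟨(Equiv.sigmaFiberEquiv f).symm.trans ((Equiv.sigmaCongrRight fun y =>
    Fintype.equivOfCardEq (h y)).trans (Equiv.sigmaFiberEquiv g)), fun x => ?_⟩
  exact ((Fintype.equivOfCardEq (h (f x))) ⟨x, rfl⟩).2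

/-- The part of the extremal graph containing a vertex: the centre, the pendant vertices, or the
rest of the clique. -/
def extremalPart (n k : ℕ) : Fin 1 ⊕ (Fin (n - (k + 2)) ⊕ Fin (k + 1)) → Fin 3
  | Sum.inl _ => 0
  | Sum.inr (Sum.inl _) => 2
  | Sum.inr (Sum.inr _) => 1

/-- A graph with a vertex isolating `k + 1` others embeds in the extremal graph on the same number
of vertices. -/
lemma exists_equiv_extremalGraph {V : Type*} [Fintype V] {G : SimpleGraph V} {n k : ℕ}
    (hcard : Fintype.card V = n) {S I : Finset V} (hS : S.card = 1) (hI : I ⊆ isolated G S)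
    (hIcard : I.card = k + 1) :
    ∃ e : V ≃ Fin 1 ⊕ (Fin (n - (k + 2)) ⊕ Fin (k + 1)),
      ∀ v w, G.Adj v w → (extremalGraph n k).Adj (e v) (e w) := by
  have hdisj : Disjoint S I := Finset.disjoint_right.2 fun v hv => (mem_isolated.1 (hI hv)).1
  have hRcard : S.card + I.card + (S ∪ I)ᶜ.card = n := by
    rw [← Finset.card_union_of_disjoint hdisj, Finset.card_add_card_compl, hcard]
  obtain ⟨e, he⟩ := exists_equiv_of_card_fiber
    (fun v => if v ∈ S then (0 : Fin 3) else if v ∈ I then 1 else 2) (extremalPart n k) (by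
      intro y
      rw [Fintype.card_subtype, Fintype.card_subtype]
      have hr : (Finset.univ.filter fun w => extremalPart n k w = y).card =
          ∑ w, if extremalPart n k w = y then 1 else 0 := by simp
      rw [hr, Fintype.sum_sum_type, Fintype.sum_sum_type]
      rcases (show y = 0 ∨ y = 1 ∨ y = 2 by omega) with rfl | rfl | rfl
      · rw [show (Finset.univ.filter fun v => (if v ∈ S then (0 : Fin 3) else
          if v ∈ I then 1 else 2) = 0) = S by ext v; simp; grind]
        simp [extremalPart, hS]
      · rw [show (Finset.univ.filter fun v => (if v ∈ S then (0 : Fin 3) else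
          if v ∈ I then 1 else 2) = 1) = I by
            ext v; have hv : v ∈ I → v ∉ S := fun h => Finset.disjoint_right.1 hdisj h
            simp only [Finset.mem_filter, Finset.mem_univ, true_and]; grind]
        simp [extremalPart, hIcard]
      · rw [show (Finset.univ.filter fun v => (if v ∈ S then (0 : Fin 3) else
          if v ∈ I then 1 else 2) = 2) = (S ∪ I)ᶜ by ext v; simp; grind]
        simp only [extremalPart, Fin.reduceEq, if_true, if_false, Finset.sum_const_zero,
          Finset.sum_const, Finset.card_univ, Fintype.card_fin, smul_eq_mul, zero_add, add_zero]
        omega)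
  refine ⟨e, fun v w hvw => ?_⟩
  have hne : e v ≠ e w := fun h => hvw.ne (e.injective h)
  -- Distinct vertices of the extremal graph are non-adjacent only if one is pendant and the other
  -- is not the centre.
  have hIS : ∀ v w, G.Adj v w → extremalPart n k (e v) = 1 → extremalPart n k (e w) = 0 := by
    intro v w hvw hv
    rw [he] at hv ⊢
    have hvI : v ∈ I := by
      by_contra h
      split_ifs at hv <;> simp at hv
    simp [(mem_isolated.1 (hI hvI)).2 w hvw]
  have h1 := hIS v w hvw
  have h2 := hIS w v hvw.symm
  revert hne h1 h2
  rcases e v with a | a | a <;> rcases e w with b | b | b <;> intro hne h1 h2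
  · exact absurd (congrArg Sum.inl (Subsingleton.elim a b)) hne
  · trivial
  · trivial
  · trivial
  · change a ≠ b
    rintro rfl
    exact hne rfl
  · exact absurd (h2 rfl) (by simp [extremalPart])
  · trivial
  · exact absurd (h1 rfl) (by simp [extremalPart])
  · exact absurd (h1 rfl) (by simp [extremalPart])

/-- The `k + 1` pendant vertices are leaves of every spanning tree of the extremal graph. -/
lemma lt_leafDegree_of_iso {V : Type*} [Fintype V] {G T : SimpleGraph V} {n k : ℕ}
    (e : G ≃g extremalGraph n k) (hT : IsSpanningTree T G) : k < leafDegree T := by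
  set c := e.symm (Sum.inl 0) with hc
  set p : Fin (k + 1) → V := fun j => e.symm (Sum.inr (Sum.inr j)) with hp
  have hnb : ∀ j w, G.Adj (p j) w → w = c := by
    intro j w h
    have h' := e.map_adj_iff.2 h
    rw [hp, RelIso.apply_symm_apply] at h'
    rw [hc, ← e.injective.eq_iff, RelIso.apply_symm_apply]
    revert h'
    rcases e w with a | a | a
    · exact fun _ => congrArg Sum.inl (Subsingleton.elim a 0)
    · exact fun h => by simp [extremalGraph, join] at h
    · exact fun h => False.elim (show False from h)
  have hpc : ∀ j, p j ≠ c := fun j h => by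
    have := e.symm.injective h
    simp at this
  have : Nontrivial V := ⟨p 0, c, hpc 0⟩
  have hnbT : ∀ j, T.neighborFinset (p j) = {c} := by
    intro j
    obtain ⟨w, hw⟩ := hT.2.connected.preconnected.exists_adj_of_nontrivial (p j)
    have hwc := hnb j w (hT.1 hw)
    subst hwc
    ext u
    rw [SimpleGraph.mem_neighborFinset, Finset.mem_singleton]
    exact ⟨fun h => hnb j u (hT.1 h), fun h => h ▸ hw⟩
  have hinj : Function.Injective p := fun i j h => by
    have := e.symm.injective h
    simpa using this
  have hle : (Finset.univ.filter fun u : V => T.Adj c u ∧ T.degree u = 1).card ≤ leafDegree T :=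
    Finset.le_sup (f := fun v : V =>
      (Finset.univ.filter fun u : V => T.Adj v u ∧ T.degree u = 1).card) (Finset.mem_univ c)
  have hsub : Finset.univ.image p ⊆
      Finset.univ.filter fun u : V => T.Adj c u ∧ T.degree u = 1 := by
    intro u hu
    obtain ⟨j, -, rfl⟩ := Finset.mem_image.1 hu
    simp only [Finset.mem_filter, Finset.mem_univ, true_and]
    refine ⟨?_, ?_⟩
    · rw [SimpleGraph.adj_comm, ← SimpleGraph.mem_neighborFinset, hnbT]
      exact Finset.mem_singleton_self c
    · rw [← SimpleGraph.card_neighborFinset_eq_degree, hnbT, Finset.card_singleton]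
  have h := Finset.card_le_card hsub
  rw [Finset.card_image_of_injective _ hinj, Finset.card_univ, Fintype.card_fin] at h
  omega

end

end SpanningLeaf

/-! ### The main theorem -/

theorem corollary4p4 {V : Type*} [Fintype V] (G : SimpleGraph V) (n k : ℕ)
    (hG : G.Connected) (hcard : Fintype.card V = n) (hk : 1 ≤ k) (hn : 2 * k + 12 ≤ n)
    (hlam : SpanningLeaf.lambdaOne (SpanningLeaf.extremalGraph n k) ≤ SpanningLeaf.lambdaOne G) :
    (∃ T : SimpleGraph V, SpanningLeaf.IsSpanningTree T G ∧ SpanningLeaf.leafDegree T ≤ k) ↔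
      ¬ Nonempty (G ≃g SpanningLeaf.extremalGraph n k) := by
  constructor
  · rintro ⟨T, hT, hle⟩ ⟨e⟩
    exact absurd hle (SpanningLeaf.lt_leafDegree_of_iso e hT).not_ge
  · intro hiso
    by_contra hT
    have hK : ¬ SpanningLeaf.KanekoCondition G k := fun hK =>
      hT (hK.exists_spanningTree hk hG (by omega))
    simp only [SpanningLeaf.KanekoCondition, not_forall, not_lt] at hK
    obtain ⟨S, hS, hle⟩ := hK
    -- Exactly `(k + 1)|S|` isolated vertices are kept; any others are treated as part of the
    -- remainder.
    obtain ⟨I, hI, hIcard⟩ := Finset.exists_subset_card_eq hle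
    have hpos := hS.card_pos
    rcases (show S.card = 1 ∨ 2 ≤ S.card by omega) with h1 | h2
    · rw [h1, mul_one] at hIcard
      obtain ⟨e, he⟩ := SpanningLeaf.exists_equiv_extremalGraph hcard h1 hI hIcard
      refine absurd hlam (SpanningLeaf.lambdaOne_lt_of_embedding hG e he ?_).not_ge
      -- If no edge were missing, `e` would be an isomorphism.
      by_contra! hcon
      exact hiso ⟨⟨e, fun {v w} => ⟨fun h => by_contra fun h' => hcon v w h' h, he v w⟩⟩⟩
    · have h3 := SpanningLeaf.lambdaOne_lt_of_isolated hG hcard hk hn hI hIcard h2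
      have h4 := SpanningLeaf.le_lambdaOne_extremalGraph (n := n) (k := k) (by omega)
      linarith
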